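/- Let $(\mathcal T,\nu)$ be a measure space such that the real Hilbert space $L^2=L^2(\mathcal T,\nu)$ is separable, with inner product $\langle x,y\rangle=\int_{\mathcal T}xy\,d\nu$ and norm $\|\cdot\|$; equip $L^2\times L^2$ with the norm $\|(x,y)\|=\|x\|\vee\|y\|$. Let $(X,Y)$ be a random element of $L^2\times L^2$ with $E X=0$ and $EY=0$ which is regularly varying with index $-\alpha$ for some $\alpha>2$, that is: there are a sequence $b(n)\to\infty$ and a Borel measure $\mu$ on $(L^2\times L^2)\setminus\{(0,0)\}$, finite on all Borel sets bounded away from $(0,0)$, with $\mu(tA)=t^{-\alpha}\mu(A)$ for all $t>0$ and all Borel sets $A\subset (L^2\times L^2)\setminus\{(0,0)\}$, such that $$ n\,\Pr\big((X,Y)/b(n)\in A\big)\longrightarrow\mu(A),\qquad n\to\infty,$$ for every Borel set $A$ that is bounded away from $(0,0)$ and satisfies $\mu(\partial A)=0$. Let $\mu$ be normalized by $\mu\{(x,y):\|x\|\vee\|y\|>1\}=1$, and assume that both marginals of $\mu$ are non-degenerate, i.e. $\mu\{(x,y):x\neq0\}>0$ and $\mu\{(x,y):y\ne0\}>0$. Define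 the extremal correlation coefficient $\rho_{XY}=\sigma_{XY}/(\sigma_X\sigma_Y)$, where $$\sigma_{XY}=\int_{\|x\|\vee\|y\|>1}\langle x,y\rangle\,\mu(dx,dy),\quad \sigma_X^2=\int_{\|x\|\vee\|y\|>1}\|x\|^2\,\mu(dx,dy),\quad \sigma_Y^2=\int_{\|x\|\vee\|y\|>1}\|y\|^2\,\mu(dx,dy),$$ with $\sigma_X,\sigma_Y\ge 0$. Let $(X_1,Y_1),(X_2,Y_2),\dots$ be independent copies of $(X,Y)$, put $R_i=\|X_i\|\vee\|Y_i\|$, let $R_{(k)}$ be the $k$-th largest of $R_1,\dots,R_n$, and let $$\hat\rho_{n,k}=\frac{\sum_{i=1}^n\langle X_i,Y_i\rangle I_{R_i\ge R_{(k)}}}{\big(\sum_{i=1}^n\|X_i\|^2I_{R_i\ge R_{(k)}}\big)^{1/2}\big(\sum_{i=1}^n\|Y_i\|^2I_{R_i\ge R_{(k)}}\big)^{1/2}}$$ (with the convention $0/0=0$). If $k=k(n)\to\infty$ and $k/n\to0$ as $n\to\infty$, then $\hat\rho_{n,k}\to\rho_{XY}$ in probability. -/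

import Mathlib

open MeasureTheory ProbabilityTheory Filter Topology
open scoped ENNReal RealInnerProductSpace Pointwise

noncomputable section

namespace ExtremalCorrelation

section RegularVariation

variable {E : Type*} [NormedAddCommGroup E] [NormedSpace ℝ E] [MeasurableSpace E]

/-- A set is bounded away from the origin if it misses some open ball centred at `0`. -/
def BoundedAway (A : Set E) : Prop :=
  ∃ ε : ℝ, 0 < ε ∧ Disjoint A (Metric.ball (0 : E) ε)

/-- `M₀(E)`: Borel measures on `E \ {0}` (seen as measures on `E` that do not charge the origin)
which are finite on the Borel sets bounded away from the origin. -/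
structure IsM0 (μ : Measure E) : Prop where
  zero_singleton : μ {0} = 0
  boundedly_finite : ∀ A : Set E, MeasurableSet A → BoundedAway A → μ A < ∞

/-- `M₀` convergence: convergence on all Borel `μ`-continuity sets bounded away from the origin.
(A possible mass of `μs n` at the origin plays no role, since such sets do not contain `0`.) -/
def M0Tendsto (μs : ℕ → Measure E) (μ : Measure E) : Prop :=
  ∀ A : Set E, MeasurableSet A → BoundedAway A → μ (frontier A) = 0 →
    Tendsto (fun n => μs n A) atTop (𝓝 (μ A))

/-- The random element `Z` of `E` is regularly varying with index `-α` and exponent measure `μ`: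
`n P(Z / b(n) ∈ ·) → μ` in `M₀(E)` for some `b(n) → ∞`, where `μ(tA) = t^{-α} μ(A)` and `μ` is
normalized by `μ {z : ‖z‖ > 1} = 1`. -/
structure IsRegularlyVarying {Ω : Type*} [MeasurableSpace Ω] (P : Measure Ω) (Z : Ω → E)
    (α : ℝ) (μ : Measure E) : Prop where
  aemeasurable : AEMeasurable Z P
  index_pos : 0 < α
  isM0 : IsM0 μ
  homogeneous : ∀ t : ℝ, 0 < t → ∀ A : Set E, MeasurableSet A → (0 : E) ∉ A →
    μ (t • A) = ENNReal.ofReal (t ^ (-α)) * μ A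
  normalized : μ {z : E | 1 < ‖z‖} = 1
  tendsto : ∃ b : ℕ → ℝ, Tendsto b atTop atTop ∧
    M0Tendsto (fun n => (n : ℝ≥0∞) • P.map (fun ω => (b n)⁻¹ • Z ω)) μ

end RegularVariation

section Marginals

variable {H : Type*} [NormedAddCommGroup H] [MeasurableSpace H]

/-- The first marginal `μ_X` of a measure on `(H × H) \ {0}`, a measure on `H \ {0}`. -/
def marginalX (μ : Measure (H × H)) : Measure H := (μ.map Prod.fst).restrict {0}ᶜ

/-- The second marginal `μ_Y` of a measure on `(H × H) \ {0}`, a measure on `H \ {0}`. -/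
def marginalY (μ : Measure (H × H)) : Measure H := (μ.map Prod.snd).restrict {0}ᶜ

end Marginals

section Coefficient

variable {H : Type*} [NormedAddCommGroup H] [InnerProductSpace ℝ H] [MeasurableSpace H]

/-- Extremal covariance `σ_XY = ∫_{‖x‖ ∨ ‖y‖ > 1} ⟨x, y⟩ μ(dx, dy)`. -/
def sigmaXY (μ : Measure (H × H)) : ℝ :=
  ∫ p in {p : H × H | 1 < max ‖p.1‖ ‖p.2‖}, ⟪p.1, p.2⟫ ∂μ

/-- `σ_X = (∫_{‖x‖ ∨ ‖y‖ > 1} ‖x‖² μ(dx, dy))^{1/2}`. -/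
def sigmaX (μ : Measure (H × H)) : ℝ :=
  Real.sqrt (∫ p in {p : H × H | 1 < max ‖p.1‖ ‖p.2‖}, ‖p.1‖ ^ 2 ∂μ)

/-- `σ_Y = (∫_{‖x‖ ∨ ‖y‖ > 1} ‖y‖² μ(dx, dy))^{1/2}`. -/
def sigmaY (μ : Measure (H × H)) : ℝ :=
  Real.sqrt (∫ p in {p : H × H | 1 < max ‖p.1‖ ‖p.2‖}, ‖p.2‖ ^ 2 ∂μ)

/-- Extremal correlation coefficient `ρ_XY = σ_XY / (σ_X σ_Y)`. -/
def rhoXY (μ : Measure (H × H)) : ℝ := sigmaXY μ / (sigmaX μ * sigmaY μ)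

end Coefficient

section Estimator

/-- The `k`-th largest of the `n` numbers `r 0, …, r (n-1)`, for `1 ≤ k ≤ n`; so `k = 1` gives the
maximum. (`Tuple.sort r` is a permutation that puts `r` in nondecreasing order.) -/
def kthLargest {n : ℕ} (r : Fin n → ℝ) (k : ℕ) : ℝ :=
  if h : 1 ≤ k ∧ k ≤ n then r (Tuple.sort r ⟨n - k, by omega⟩) else 0

variable {H : Type*} [NormedAddCommGroup H] [InnerProductSpace ℝ H]

/-- `R_i = ‖x_i‖ ∨ ‖y_i‖`. -/
def pairNorm {n : ℕ} (x y : Fin n → H) (i : Fin n) : ℝ := max ‖x i‖ ‖y i‖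

/-- The pairs used by the estimator, i.e. the indices with `R_i ≥ R_(k)`. -/
def extremeIndices {n : ℕ} (k : ℕ) (x y : Fin n → H) : Finset (Fin n) :=
  Finset.univ.filter (fun i => kthLargest (pairNorm x y) k ≤ pairNorm x y i)

/-- The estimator `ρ̂_{n,k}` of the extremal correlation coefficient. -/
def rhoHat {n : ℕ} (k : ℕ) (x y : Fin n → H) : ℝ :=
  (∑ i ∈ extremeIndices k x y, ⟪x i, y i⟫) /
    (Real.sqrt (∑ i ∈ extremeIndices k x y, ‖x i‖ ^ 2) *
      Real.sqrt (∑ i ∈ extremeIndices k x y, ‖y i‖ ^ 2))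

end Estimator

end ExtremalCorrelation

end

/-!
Write `Z = (X, Y)`, `R = ‖Z‖`, and scale the observations by `a n = b ⌊n / k n⌋`, the size of the
`k n`-th largest of `n` observations. The estimator is a continuous function of the normalized sums
`k⁻¹ ∑ f (Z i / a n)` over the indices with `R i ≥ R_(k)`, where `f` is one of the nonnegative
quadratic functions `‖x‖²`, `‖y‖²`, `‖x + y‖²`, `‖x - y‖²` (the inner product is recovered by
polarization), and the coefficient is the same function of the integrals of `f` over `{‖z‖ > 1}`.
The denominator of the limit does not vanish, because `μ` is homogeneous and has non-degenerate
marginals. It remains to show that these sums converge in probability to these integrals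
(`IsIntermediateScaling.tendsto_sum_extremes`).

For a continuity set `A` bounded away from the origin, the empirical frequency
`k⁻¹ #{i < n : Z i / a n ∈ A}` has mean converging to `μ A` and variance `O(1 / k)`, so it converges
to `μ A` in mean. Applied to `A = {‖z‖ > s}` this gives `R_(k) / a n → 1`
(`IsIntermediateScaling.eventually_kthLargest`), so that sums over `R i ≥ R_(k)` lie between sums
over `R i > s a n` with deterministic `s` close to `1`. The latter sums are integrals over `t > 0` of
the empirical frequencies of `{f > t, ‖z‖ > s}` (layer cake), and the mean error is at most the
integral over `t` of the mean errors of these frequencies. Dominated convergence applies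
(`IsIntermediateScaling.tendsto_sum_indicator`): a Potter bound on the tail of `R` with an exponent
`β ∈ (2, α)` bounds the frequencies by a multiple of `(1 + t) ^ (-β / 2)`, uniformly in `n`. In this
way no second moments of `f (Z)`, which need not exist, are used.

Convergence in probability is handled as convergence along the filter `highProbability P` on
`ℕ × Ω`, which reduces the continuous mapping and sandwich arguments to limits along a filter.
-/

namespace ExtremalCorrelation

/-! ### Convergence in probability as convergence along a filter -/

section HighProbability

variable {Ω : Type*} [MeasurableSpace Ω]

/-- The filter on `ℕ × Ω` of sequences of events whose probability tends to one. Convergence in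
probability of random variables `f n` to a constant is convergence of `(n, ω) ↦ f n ω` along this
filter, so that the usual calculus of limits applies to it. -/
def highProbability (P : Measure Ω) : Filter (ℕ × Ω) where
  sets := {S | Tendsto (fun n => P {ω | (n, ω) ∉ S}) atTop (𝓝 0)}
  univ_sets := by simp
  sets_of_superset := by
    intro S S' hS hSS'
    refine tendsto_of_tendsto_of_tendsto_of_le_of_le tendsto_const_nhds hS (fun _ => zero_le) ?_
    exact fun n => measure_mono fun ω hω h => hω (hSS' h)
  inter_sets := by
    intro S S' hS hS'
    have h := Tendsto.add hS hS'
    rw [add_zero] at h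
    refine tendsto_of_tendsto_of_tendsto_of_le_of_le tendsto_const_nhds h (fun _ => zero_le) ?_
    intro n
    refine (measure_mono ?_).trans (measure_union_le _ _)
    intro ω hω
    simp only [Set.mem_ofPred_eq, Set.mem_inter_iff, Set.mem_union] at hω ⊢
    tauto

theorem eventually_highProbability_iff {P : Measure Ω} {p : ℕ × Ω → Prop} :
    (∀ᶠ x in highProbability P, p x) ↔ Tendsto (fun n => P {ω | ¬ p (n, ω)}) atTop (𝓝 0) :=
  Iff.rfl

theorem tendsto_fst_highProbability (P : Measure Ω) :
    Tendsto Prod.fst (highProbability P) atTop := by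
  intro S hS
  change Tendsto (fun n => P {ω | (n, ω) ∉ Prod.fst ⁻¹' S}) atTop (𝓝 0)
  refine tendsto_const_nhds.congr' ?_
  filter_upwards [hS] with n hn
  simp [hn]

theorem tendstoInMeasure_of_tendsto_highProbability {P : Measure Ω} {f : ℕ → Ω → ℝ} {c : ℝ}
    (h : Tendsto (fun x : ℕ × Ω => f x.1 x.2) (highProbability P) (𝓝 c)) :
    TendstoInMeasure P f atTop (fun _ => c) := by
  rw [tendstoInMeasure_iff_dist]
  intro ε hε
  have := eventually_highProbability_iff.1 (h.eventually (Metric.ball_mem_nhds c hε))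
  simpa [Metric.mem_ball, not_lt] using this

/-- Convergence in mean implies convergence in probability (Markov's inequality). -/
theorem tendsto_highProbability_of_tendsto_lintegral {P : Measure Ω} {f : ℕ → Ω → ℝ} {c : ℝ}
    (hf : ∀ n, Measurable (f n))
    (h : Tendsto (fun n => ∫⁻ ω, ‖f n ω - c‖ₑ ∂P) atTop (𝓝 0)) :
    Tendsto (fun x : ℕ × Ω => f x.1 x.2) (highProbability P) (𝓝 c) := by
  refine Metric.tendsto_nhds.2 fun ε hε => eventually_highProbability_iff.2 ?_
  have hε' : ENNReal.ofReal ε ≠ 0 := by simpa using hε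
  have h2 := ENNReal.Tendsto.div_const h (b := ENNReal.ofReal ε) (Or.inr hε')
  rw [ENNReal.zero_div] at h2
  refine tendsto_of_tendsto_of_tendsto_of_le_of_le tendsto_const_nhds h2 (fun _ => zero_le) ?_
  intro n
  refine le_trans (measure_mono ?_) (meas_ge_le_lintegral_div
    ((hf n).sub_const c).enorm.aemeasurable hε' ENNReal.ofReal_ne_top)
  intro ω hω
  simp only [Set.mem_ofPred_eq, not_lt, Real.dist_eq] at hω ⊢
  rw [Real.enorm_eq_ofReal_abs]
  exact ENNReal.ofReal_le_ofReal hω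

end HighProbability

/-! ### Order statistics -/

theorem lt_kthLargest_iff {n k : ℕ} (r : Fin n → ℝ) (hk : 1 ≤ k) (hkn : k ≤ n) (c : ℝ) :
    c < kthLargest r k ↔ k ≤ (Finset.univ.filter fun i => c < r i).card := by
  have hdef : kthLargest r k = r (Tuple.sort r ⟨n - k, by omega⟩) := by
    simp [kthLargest, hk, hkn]
  have hmono := Tuple.monotone_sort r
  have hcard : (Finset.univ.filter fun i => c < r i).card
      = (Finset.univ.filter fun j => c < r (Tuple.sort r j)).card := by
    refine (Finset.card_bij (fun j _ => Tuple.sort r j) ?_ ?_ ?_).symm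
    · intro j hj; simpa using hj
    · intro i _ j _ hij; exact (Tuple.sort r).injective hij
    · intro i hi; exact ⟨(Tuple.sort r).symm i, by simpa using hi, by simp⟩
  rw [hdef, hcard]
  constructor
  · intro h
    have hsub : Finset.Ici (⟨n - k, by omega⟩ : Fin n)
        ⊆ Finset.univ.filter fun j => c < r (Tuple.sort r j) := by
      intro j hj
      simp only [Finset.mem_filter, Finset.mem_univ, true_and]
      exact h.trans_le (hmono (Finset.mem_Ici.1 hj))
    have := Finset.card_le_card hsub
    rw [Fin.card_Ici] at this
    simp only at this
    omega
  · intro h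
    by_contra hc
    have hsub : (Finset.univ.filter fun j => c < r (Tuple.sort r j))
        ⊆ Finset.Ioi (⟨n - k, by omega⟩ : Fin n) := by
      intro j hj
      simp only [Finset.mem_filter, Finset.mem_univ, true_and] at hj
      rw [Finset.mem_Ioi]
      by_contra hj'
      exact hc (hj.trans_le (hmono (not_lt.1 hj')))
    have := Finset.card_le_card hsub
    rw [Fin.card_Ioi] at this
    simp only at this
    omega

/-! ### Potter bounds for regularly varying tails -/

section Potter

variable {F : ℝ → ℝ} {b : ℕ → ℝ} {α β : ℝ}

/-- A tail function which is regularly varying along a sequence decays geometrically along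
dyadic multiples: for `t` large, take `n` with `n F(t) ≈ 1`, so that `t ≈ b n`. -/
theorem exists_forall_tail_two_mul_le (hF : Antitone F) (hF0 : Tendsto F atTop (𝓝 0))
    (hb : Tendsto b atTop atTop) (hα : 0 < α) (hβ : β < α)
    (h : ∀ x : ℝ, 0 < x → Tendsto (fun n : ℕ => (n : ℝ) * F (x * b n)) atTop (𝓝 (x ^ (-α)))) :
    ∃ T > 0, ∀ t ≥ T, F (2 * t) ≤ 2 ^ (-β) * F t := by
  have hpos : ∀ t, 0 < F t := by
    intro t
    have h1 := h 1 one_pos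
    rw [Real.one_rpow] at h1
    obtain ⟨n, hn1, hn2⟩ := ((h1.eventually (lt_mem_nhds one_pos)).and
      (hb.eventually_ge_atTop t)).exists
    have h2 : 0 < F (1 * b n) := by
      by_contra hc
      exact absurd hn1 (not_lt.2 (mul_nonpos_of_nonneg_of_nonpos (Nat.cast_nonneg n) (not_lt.1 hc)))
    rw [one_mul] at h2
    exact h2.trans_le (hF hn2)
  -- the factor `θ < 1` is so close to `1` that `(2 θ) ^ (-α) < 2 ^ (-β)`
  obtain ⟨θ, hθ0, hθ1, hθ⟩ : ∃ θ : ℝ, 0 < θ ∧ θ < 1 ∧ (2 * θ) ^ (-α) < (2 : ℝ) ^ (-β) := by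
    have hc : ContinuousAt (fun θ : ℝ => (2 * θ) ^ (-α)) 1 :=
      ContinuousAt.rpow_const (by fun_prop) (by norm_num)
    have h1 : ∀ᶠ θ in 𝓝 (1 : ℝ), (2 * θ) ^ (-α) < (2 : ℝ) ^ (-β) := by
      refine hc.eventually (gt_mem_nhds ?_)
      simp only [mul_one]
      exact Real.rpow_lt_rpow_of_exponent_lt (by norm_num) (by linarith)
    have h2 := ((h1.filter_mono nhdsWithin_le_nhds).and
      ((eventually_mem_nhdsWithin).and ((lt_mem_nhds (zero_lt_one' ℝ)).filter_mono
        nhdsWithin_le_nhds)) : ∀ᶠ θ in 𝓝[<] (1 : ℝ), _)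
    obtain ⟨θ, h3, h4, h5⟩ := h2.exists
    exact ⟨θ, h5, h4, h3⟩
  have hinv : Tendsto (fun t => (F t)⁻¹) atTop atTop :=
    tendsto_inv_nhdsGT_zero.comp (tendsto_nhdsWithin_iff.2 ⟨hF0, Eventually.of_forall hpos⟩)
  have hN : Tendsto (fun t => ⌈(F t)⁻¹⌉₊) atTop atTop := tendsto_nat_ceil_atTop.comp hinv
  have hNF : Tendsto (fun t => (⌈(F t)⁻¹⌉₊ : ℝ) * F t) atTop (𝓝 1) := by
    have := (tendsto_nat_ceil_div_atTop (R := ℝ)).comp hinv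
    refine this.congr fun t => ?_
    simp [div_eq_mul_inv]
  have hθα : 1 < θ ^ (-α) := Real.one_lt_rpow_of_pos_of_lt_one_of_neg hθ0 hθ1 (by linarith)
  have e1 : ∀ᶠ t in atTop, θ * b ⌈(F t)⁻¹⌉₊ < t := by
    filter_upwards [hNF.eventually_lt ((h θ hθ0).comp hN) hθα, hN.eventually_gt_atTop 0]
      with t ht hn
    by_contra hc
    have : F (θ * b ⌈(F t)⁻¹⌉₊) ≤ F t := hF (not_lt.1 hc)
    have := mul_le_mul_of_nonneg_left this (Nat.cast_nonneg (α := ℝ) ⌈(F t)⁻¹⌉₊)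
    exact absurd ht (not_lt.2 this)
  have e2 : ∀ᶠ t in atTop, (⌈(F t)⁻¹⌉₊ : ℝ) * F (2 * θ * b ⌈(F t)⁻¹⌉₊)
      < 2 ^ (-β) * (⌈(F t)⁻¹⌉₊ * F t) := by
    refine ((h (2 * θ) (by positivity)).comp hN).eventually_lt (hNF.const_mul _) ?_
    simpa using hθ
  obtain ⟨T, hT⟩ := eventually_atTop.1 ((e1.and e2).and (hN.eventually_gt_atTop 0))
  refine ⟨max T 1, by positivity, fun t ht => ?_⟩
  obtain ⟨⟨h1, h2⟩, h3⟩ := hT t (le_of_max_le_left ht)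
  have h4 : F (2 * t) ≤ F (2 * θ * b ⌈(F t)⁻¹⌉₊) := hF (by linarith)
  have h5 : (0 : ℝ) < ⌈(F t)⁻¹⌉₊ := by exact_mod_cast h3
  refine h4.trans (le_of_mul_le_mul_left ?_ h5)
  linarith

theorem tail_mul_le_of_tail_two_mul_le {T : ℝ} (hF : Antitone F) (hFnn : ∀ t, 0 ≤ F t)
    (hβ : 0 ≤ β) (hT : 0 < T) (h : ∀ t ≥ T, F (2 * t) ≤ 2 ^ (-β) * F t)
    {t l : ℝ} (ht : T ≤ t) (hl : 1 ≤ l) : F (l * t) ≤ 2 ^ β * l ^ (-β) * F t := by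
  have hpow : ∀ j : ℕ, F (2 ^ j * t) ≤ ((2 : ℝ) ^ j) ^ (-β) * F t := by
    intro j
    induction j with
    | zero => simp
    | succ j ih =>
      have h1 : T ≤ 2 ^ j * t := ht.trans (le_mul_of_one_le_left (hT.le.trans ht)
        (one_le_pow₀ (by norm_num)))
      calc F (2 ^ (j + 1) * t) = F (2 * (2 ^ j * t)) := by ring_nf
        _ ≤ 2 ^ (-β) * F (2 ^ j * t) := h _ h1
        _ ≤ 2 ^ (-β) * (((2 : ℝ) ^ j) ^ (-β) * F t) := by gcongr
        _ = _ := by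
          rw [← mul_assoc, ← Real.mul_rpow (by norm_num) (by positivity), pow_succ']
  obtain ⟨j, hj1, hj2⟩ := exists_nat_pow_near hl (one_lt_two)
  have ht0 : 0 < t := hT.trans_le ht
  calc F (l * t) ≤ F (2 ^ j * t) := hF (by gcongr)
    _ ≤ ((2 : ℝ) ^ j) ^ (-β) * F t := hpow j
    _ ≤ 2 ^ β * l ^ (-β) * F t := by
      refine mul_le_mul_of_nonneg_right ?_ (hFnn t)
      have h1 : ((2 : ℝ) ^ (j + 1)) ^ (-β) ≤ l ^ (-β) :=
        Real.rpow_le_rpow_of_nonpos (by linarith) hj2.le (by linarith)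
      have h2 : (2 : ℝ) ^ β * ((2 : ℝ) ^ (j + 1)) ^ (-β) = ((2 : ℝ) ^ j) ^ (-β) := by
        rw [pow_succ', Real.mul_rpow (by norm_num) (by positivity), ← mul_assoc,
          ← Real.rpow_add (by norm_num)]
        simp
      rw [← h2]
      gcongr

end Potter

/-! ### The exponent measure and intermediate sequences -/

section ExponentMeasure

variable {E : Type*} [NormedAddCommGroup E]

theorem boundedAway_of_forall_le_norm {A : Set E} {s : ℝ} (hs : 0 < s) (h : ∀ z ∈ A, s ≤ ‖z‖) :
    BoundedAway A := by
  refine ⟨s, hs, Set.disjoint_left.2 fun z hz hz' => ?_⟩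
  rw [mem_ball_zero_iff] at hz'
  exact absurd (h z hz) (not_le.2 hz')

variable [MeasurableSpace E] [BorelSpace E]

theorem measurableSet_lt_norm (s : ℝ) : MeasurableSet {z : E | s < ‖z‖} :=
  (isOpen_lt continuous_const continuous_norm).measurableSet

variable [NormedSpace ℝ E] {Ω₀ : Type*} [MeasurableSpace Ω₀] {P₀ : Measure Ω₀} {Z : Ω₀ → E}
  {α : ℝ} {μ : Measure E}

/-- Scaling constants `a n` for which the number of rescaled observations per `k n` extremes
converges: `(n / k n) Q (a n • ·) → μ` on continuity sets bounded away from the origin, with a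
Potter bound of exponent `-β` on the tails of these measures that is uniform in `n`. -/
structure IsIntermediateScaling (Q μ : Measure E) (k : ℕ → ℕ) (a : ℕ → ℝ) (β : ℝ) : Prop where
  pos : ∀ᶠ n in atTop, 0 < a n
  tendsto : ∀ A : Set E, MeasurableSet A → BoundedAway A → μ (frontier A) = 0 →
    Tendsto (fun n : ℕ => ((n : ℝ) / k n) * Q.real {z | (a n)⁻¹ • z ∈ A}) atTop (𝓝 (μ.real A))
  tail_le : ∀ u₀ : ℝ, 0 < u₀ → ∃ K : ℝ, ∀ᶠ n : ℕ in atTop, ∀ u ≥ u₀,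
    ((n : ℝ) / k n) * Q.real {z | u < ‖(a n)⁻¹ • z‖} ≤ K * u ^ (-β)

namespace IsRegularlyVarying

theorem measure_lt_norm (h : IsRegularlyVarying P₀ Z α μ) {s : ℝ} (hs : 0 < s) :
    μ {z | s < ‖z‖} = ENNReal.ofReal (s ^ (-α)) := by
  have h1 : {z : E | s < ‖z‖} = s • {z : E | 1 < ‖z‖} := by
    ext z
    rw [Set.mem_smul_set_iff_inv_smul_mem₀ hs.ne']
    simp only [Set.mem_ofPred_eq, norm_smul, norm_inv, Real.norm_eq_abs, abs_of_pos hs]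
    rw [← div_eq_inv_mul, one_lt_div hs]
  rw [h1, h.homogeneous s hs _ (measurableSet_lt_norm 1) (by simp), h.normalized, mul_one]

theorem measure_lt_norm_lt_top (h : IsRegularlyVarying P₀ Z α μ) {s : ℝ} (hs : 0 < s) :
    μ {z | s < ‖z‖} < ∞ := by
  rw [h.measure_lt_norm hs]; exact ENNReal.ofReal_lt_top

theorem measureReal_lt_norm (h : IsRegularlyVarying P₀ Z α μ) {s : ℝ} (hs : 0 < s) :
    μ.real {z | s < ‖z‖} = s ^ (-α) := by
  rw [Measure.real, h.measure_lt_norm hs, ENNReal.toReal_ofReal (by positivity)]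

/-- Spheres are null sets, since `s ↦ μ {‖z‖ > s} = s ^ (-α)` is continuous. -/
theorem measure_norm_eq (h : IsRegularlyVarying P₀ Z α μ) {s : ℝ} (hs : 0 < s) :
    μ {z | ‖z‖ = s} = 0 := by
  have hle : ∀ r : ℝ, 0 < r → r < s →
      μ {z | ‖z‖ = s} ≤ ENNReal.ofReal (r ^ (-α)) - ENNReal.ofReal (s ^ (-α)) := by
    intro r hr hrs
    have hsub : {z : E | s < ‖z‖} ⊆ {z | r < ‖z‖} := fun z (hz : s < ‖z‖) => hrs.trans hz
    rw [← h.measure_lt_norm hr, ← h.measure_lt_norm hs, ← measure_sdiff hsub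
        (measurableSet_lt_norm s).nullMeasurableSet (h.measure_lt_norm_lt_top hs).ne]
    refine measure_mono fun z (hz : ‖z‖ = s) => ⟨?_, ?_⟩
    · exact hrs.trans_eq hz.symm
    · exact not_lt.2 hz.le
  have hc : Tendsto (fun r : ℝ => ENNReal.ofReal (r ^ (-α)) - ENNReal.ofReal (s ^ (-α)))
      (𝓝[<] s) (𝓝 (ENNReal.ofReal (s ^ (-α)) - ENNReal.ofReal (s ^ (-α)))) := by
    refine ENNReal.Tendsto.sub (ENNReal.tendsto_ofReal ?_) tendsto_const_nhds
      (Or.inl ENNReal.ofReal_ne_top)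
    exact (Real.continuousAt_rpow_const s (-α) (Or.inl hs.ne')).mono_left nhdsWithin_le_nhds
  rw [tsub_self] at hc
  refine le_antisymm (ge_of_tendsto hc ?_) zero_le
  filter_upwards [(lt_mem_nhds hs).filter_mono nhdsWithin_le_nhds, eventually_mem_nhdsWithin]
    with r hr hrs using hle r hr hrs

theorem measure_frontier_lt_norm (h : IsRegularlyVarying P₀ Z α μ) {s : ℝ} (hs : 0 < s) :
    μ (frontier {z | s < ‖z‖}) = 0 := by
  refine measure_mono_null (fun z hz => ?_) (h.measure_norm_eq hs)
  exact (frontier_lt_subset_eq continuous_const continuous_norm hz).symm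

theorem exists_tendsto_measureReal (h : IsRegularlyVarying P₀ Z α μ) :
    ∃ b : ℕ → ℝ, Tendsto b atTop atTop ∧
      ∀ A : Set E, MeasurableSet A → BoundedAway A → μ (frontier A) = 0 →
        Tendsto (fun n : ℕ => (n : ℝ) * (P₀.map Z).real {z | (b n)⁻¹ • z ∈ A}) atTop
          (𝓝 (μ.real A)) := by
  obtain ⟨b, hb, hconv⟩ := h.tendsto
  refine ⟨b, hb, fun A hA hA0 hAf => ?_⟩
  have h1 := (ENNReal.tendsto_toReal (h.isM0.boundedly_finite A hA hA0).ne).comp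
    (hconv A hA hA0 hAf)
  refine h1.congr fun n => ?_
  have h2 : P₀.map (fun ω => (b n)⁻¹ • Z ω) = (P₀.map Z).map (fun z => (b n)⁻¹ • z) :=
    (AEMeasurable.map_map_of_aemeasurable (measurable_const_smul _).aemeasurable
      h.aemeasurable).symm
  simp only [Function.comp_apply, Measure.smul_apply, smul_eq_mul, ENNReal.toReal_mul,
    ENNReal.toReal_natCast, h2, Measure.real]
  rw [Measure.map_apply (measurable_const_smul _) hA]
  rfl

/-- For an intermediate sequence, `k n → ∞` and `k n / n → 0`, one may scale by the normalizing
constant of index `⌊n / k n⌋`. -/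
theorem exists_intermediate [IsProbabilityMeasure P₀] (h : IsRegularlyVarying P₀ Z α μ) {β : ℝ}
    (hβ0 : 0 ≤ β) (hβ : β < α) {k : ℕ → ℕ} (hk : Tendsto k atTop atTop)
    (hkn : Tendsto (fun n : ℕ => (k n : ℝ) / (n : ℝ)) atTop (𝓝 0)) :
    ∃ a : ℕ → ℝ, IsIntermediateScaling (P₀.map Z) μ k a β := by
  have : IsProbabilityMeasure (P₀.map Z) := Measure.isProbabilityMeasure_map h.aemeasurable
  obtain ⟨b, hb, hconv⟩ := h.exists_tendsto_measureReal
  set Q := P₀.map Z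
  set F : ℝ → ℝ := fun t => Q.real {z | t < ‖z‖}
  have hFdef : ∀ t, F t = Q.real {z | t < ‖z‖} := fun _ => rfl
  have hFanti : Antitone F := fun s t hst =>
    measureReal_mono fun z (hz : t < ‖z‖) => hst.trans_lt hz
  have hFnn : ∀ t, 0 ≤ F t := fun t => measureReal_nonneg
  have hF0 : Tendsto F atTop (𝓝 0) := by
    have h1 : Tendsto (fun t : ℝ => Q {z : E | t < ‖z‖}) atTop
        (𝓝 (Q (⋂ t : ℝ, {z : E | t < ‖z‖}))) :=
      tendsto_measure_iInter_atTop (fun t => (measurableSet_lt_norm t).nullMeasurableSet)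
        (fun s t hst z (hz : t < ‖z‖) => hst.trans_lt hz) ⟨0, measure_ne_top _ _⟩
    have h2 : (⋂ t : ℝ, {z : E | t < ‖z‖}) = ∅ := by
      ext z
      simp only [Set.mem_iInter, Set.mem_ofPred_eq, Set.mem_empty_iff_false, iff_false, not_forall]
      exact ⟨‖z‖, lt_irrefl _⟩
    rw [h2, measure_empty] at h1
    exact (ENNReal.tendsto_toReal ENNReal.zero_ne_top).comp h1
  have hset : ∀ c : ℝ, 0 < c → ∀ u : ℝ, {z : E | u < ‖c⁻¹ • z‖} = {z | u * c < ‖z‖} := by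
    intro c hc u
    ext z
    simp only [Set.mem_ofPred_eq, norm_smul, norm_inv, Real.norm_eq_abs, abs_of_pos hc]
    rw [← div_eq_inv_mul, lt_div_iff₀ hc]
  have hFseq : ∀ x : ℝ, 0 < x →
      Tendsto (fun n : ℕ => (n : ℝ) * F (x * b n)) atTop (𝓝 (x ^ (-α))) := by
    intro x hx
    rw [← h.measureReal_lt_norm hx]
    refine (hconv _ (measurableSet_lt_norm x)
      (boundedAway_of_forall_le_norm hx fun z (hz : x < ‖z‖) => hz.le)
      (h.measure_frontier_lt_norm hx)).congr' ?_
    filter_upwards [hb.eventually_gt_atTop 0] with n hn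
    rw [hFdef, ← hset _ hn]
  obtain ⟨T, hT0, hT⟩ := exists_forall_tail_two_mul_le hFanti hF0 hb h.index_pos hβ hFseq
  -- `n / k n → ∞`
  have hratio : Tendsto (fun n : ℕ => (n : ℝ) / k n) atTop atTop := by
    have h1 : Tendsto (fun n : ℕ => ((k n : ℝ) / n)⁻¹) atTop atTop := by
      refine tendsto_inv_nhdsGT_zero.comp (tendsto_nhdsWithin_iff.2 ⟨hkn, ?_⟩)
      filter_upwards [hk.eventually_gt_atTop 0, eventually_gt_atTop 0] with n h1 h2
      have h1' : (0 : ℝ) < k n := by exact_mod_cast h1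
      have h2' : (0 : ℝ) < n := by exact_mod_cast h2
      exact div_pos h1' h2'
    simpa using h1
  have hm : Tendsto (fun n : ℕ => ⌊(n : ℝ) / k n⌋₊) atTop atTop :=
    tendsto_nat_floor_atTop.comp hratio
  have hmr : Tendsto (fun n : ℕ => ((n : ℝ) / k n) / (⌊(n : ℝ) / k n⌋₊ : ℝ)) atTop (𝓝 1) := by
    have := ((tendsto_nat_floor_div_atTop (R := ℝ)).comp hratio).inv₀ one_ne_zero
    simpa using this
  have hA : ∀ A : Set E, MeasurableSet A → BoundedAway A → μ (frontier A) = 0 →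
      Tendsto (fun n : ℕ => ((n : ℝ) / k n) * Q.real {z | (b ⌊(n : ℝ) / k n⌋₊)⁻¹ • z ∈ A}) atTop
        (𝓝 (μ.real A)) := by
    intro A hA hA0 hAf
    have h1 := hmr.mul ((hconv A hA hA0 hAf).comp hm)
    rw [one_mul] at h1
    refine h1.congr' ?_
    filter_upwards [hm.eventually_gt_atTop 0] with n hn
    have : ((⌊(n : ℝ) / k n⌋₊ : ℕ) : ℝ) ≠ 0 := by exact_mod_cast hn.ne'
    simp only [Function.comp_apply]
    rw [← mul_assoc, div_mul_cancel₀ _ this]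
  refine ⟨fun n => b ⌊(n : ℝ) / k n⌋₊, (hb.comp hm).eventually_gt_atTop 0, hA, fun u₀ hu₀ => ?_⟩
  refine ⟨2 ^ β * (u₀⁻¹) ^ (-β) * (u₀ ^ (-α) + 1), ?_⟩
  have h1 := hA _ (measurableSet_lt_norm u₀)
      (boundedAway_of_forall_le_norm hu₀ fun z (hz : u₀ < ‖z‖) => hz.le)
      (h.measure_frontier_lt_norm hu₀)
  rw [h.measureReal_lt_norm hu₀] at h1
  filter_upwards [h1.eventually_le_const (lt_add_one _), (hb.comp hm).eventually_gt_atTop 0,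
    (hb.comp hm).eventually_ge_atTop (T / u₀)] with n h2 hn0 hnT u hu
  simp only [Function.comp_apply] at hn0 hnT
  set c := b ⌊(n : ℝ) / k n⌋₊
  have hu0 : 0 < u := hu₀.trans_le hu
  have h3 : F (u * c) ≤ 2 ^ β * (u / u₀) ^ (-β) * F (u₀ * c) := by
    have := tail_mul_le_of_tail_two_mul_le hFanti hFnn hβ0 hT0 hT (t := u₀ * c) (l := u / u₀)
      (by rwa [div_le_iff₀' hu₀] at hnT) ((one_le_div hu₀).2 hu)
    rwa [show u / u₀ * (u₀ * c) = u * c by field_simp] at this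
  have h4 : (n : ℝ) / k n * F (u₀ * c) ≤ u₀ ^ (-α) + 1 := by
    rw [hFdef, ← hset _ hn0]; exact h2
  rw [hset _ hn0]
  calc (n : ℝ) / k n * F (u * c)
      ≤ (n : ℝ) / k n * (2 ^ β * (u / u₀) ^ (-β) * F (u₀ * c)) := by gcongr
    _ = 2 ^ β * (u / u₀) ^ (-β) * ((n : ℝ) / k n * F (u₀ * c)) := by ring
    _ ≤ 2 ^ β * (u / u₀) ^ (-β) * (u₀ ^ (-α) + 1) := by gcongr
    _ = _ := by
      rw [div_eq_mul_inv, Real.mul_rpow hu0.le (by positivity)]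
      ring

end IsRegularlyVarying

end ExponentMeasure

/-! ### Laws of large numbers for the extremes -/

section LawOfLargeNumbers

variable {Ω : Type*} [MeasurableSpace Ω] {P : Measure Ω} [IsProbabilityMeasure P]

theorem integral_abs_sub_le_sqrt_variance {S : Ω → ℝ} (hS : MemLp S 2 P) :
    ∫ ω, |S ω - ∫ ω', S ω' ∂P| ∂P ≤ Real.sqrt (variance S P) := by
  have h1 : MemLp (fun ω => S ω - ∫ ω', S ω' ∂P) 2 P := hS.sub (memLp_const _)
  have h2 := variance_nonneg (fun ω => |S ω - ∫ ω', S ω' ∂P|) P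
  have h4 : variance (fun ω => |S ω - ∫ ω', S ω' ∂P|) P = _ := variance_eq_sub h1.abs
  rw [h4] at h2
  refine Real.le_sqrt_of_sq_le ?_
  rw [variance_eq_integral hS.aemeasurable]
  have h3 : P[(fun ω => |S ω - ∫ ω', S ω' ∂P|) ^ 2] = ∫ ω, (S ω - ∫ ω', S ω' ∂P) ^ 2 ∂P :=
    integral_congr_ae (Eventually.of_forall fun ω => by simp [sq_abs])
  rw [h3] at h2
  linarith

variable {E : Type*} [MeasurableSpace E]

/-- The empirical frequency `k⁻¹ #{i < n : W i ∈ A}` of i.i.d. observations is close in mean to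
its expectation, since its variance is at most that expectation divided by `k`. -/
theorem lintegral_enorm_frequency_sub_le {W : ℕ → Ω → E} (hW : ∀ i, Measurable (W i))
    (hind : iIndepFun W P) {A : Set E} (hA : MeasurableSet A) {p : ℝ}
    (hp : ∀ i, P.real (W i ⁻¹' A) = p) (n k : ℕ) {m : ℝ} (hm : 0 ≤ m) :
    ∫⁻ ω, ‖(k : ℝ)⁻¹ * ∑ i ∈ Finset.range n, A.indicator 1 (W i ω) - m‖ₑ ∂P
        ≤ ENNReal.ofReal (Real.sqrt (((n : ℝ) / k * p) * (k : ℝ)⁻¹) + |(n : ℝ) / k * p - m|) ∧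
    ∫⁻ ω, ‖(k : ℝ)⁻¹ * ∑ i ∈ Finset.range n, A.indicator 1 (W i ω) - m‖ₑ ∂P
        ≤ ENNReal.ofReal ((n : ℝ) / k * p + m) := by
  set φ : E → ℝ := A.indicator 1 with hφ
  have hφm : Measurable φ := measurable_one.indicator hA
  have hφ0 : ∀ z, 0 ≤ φ z := fun z => Set.indicator_nonneg (by simp) z
  have hφ1 : ∀ z, φ z ≤ 1 := fun z => Set.indicator_le_self' (by simp) z
  have hφsq : ∀ z, φ z ^ 2 = φ z := fun z => by
    by_cases hz : z ∈ A <;> simp [hφ, hz]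
  have hX : ∀ i, MemLp (fun ω => φ (W i ω)) 2 P := fun i =>
    MemLp.of_bound (hφm.comp (hW i)).aestronglyMeasurable 1
      (Eventually.of_forall fun ω => by rw [Real.norm_of_nonneg (hφ0 _)]; exact hφ1 _)
  have hmean : ∀ i, ∫ ω, φ (W i ω) ∂P = p := fun i => by
    rw [← hp i, ← integral_indicator_one (hW i hA)]
    rfl
  have hvar : ∀ i, variance (fun ω => φ (W i ω)) P ≤ p := fun i => by
    refine (variance_le_expectation_sq (hX i).aestronglyMeasurable).trans (le_of_eq ?_)
    rw [← hmean i]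
    exact integral_congr_ae (Eventually.of_forall fun ω => hφsq _)
  set S : Ω → ℝ := fun ω => (k : ℝ)⁻¹ * ∑ i ∈ Finset.range n, φ (W i ω) with hSdef
  have hS : MemLp S 2 P := (memLp_finsetSum _ fun i _ => hX i).const_mul _
  have hS1 : Integrable S P := hS.integrable (by norm_num)
  have hS0 : ∀ ω, 0 ≤ S ω := fun ω =>
    mul_nonneg (by positivity) (Finset.sum_nonneg fun i _ => hφ0 _)
  have hSmean : ∫ ω, S ω ∂P = (n : ℝ) / k * p := by
    rw [integral_const_mul, integral_finsetSum _ fun i _ => (hX i).integrable (by norm_num)]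
    simp [hmean]
    ring
  have hSvar : variance S P ≤ ((n : ℝ) / k * p) * (k : ℝ)⁻¹ := by
    have h1 : variance (∑ i ∈ Finset.range n, fun ω => φ (W i ω)) P
        = ∑ i ∈ Finset.range n, variance (fun ω => φ (W i ω)) P :=
      IndepFun.variance_sum (fun i _ => hX i) fun i _ j _ hij =>
        (hind.indepFun hij).comp hφm hφm
    have h2 : variance S P
        = ((k : ℝ)⁻¹) ^ 2 * ∑ i ∈ Finset.range n, variance (fun ω => φ (W i ω)) P := by
      rw [← h1, ← variance_const_mul]
      congr 1
      ext ω
      simp [hSdef]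
    rw [h2]
    calc ((k : ℝ)⁻¹) ^ 2 * ∑ i ∈ Finset.range n, variance (fun ω => φ (W i ω)) P
        ≤ ((k : ℝ)⁻¹) ^ 2 * ∑ i ∈ Finset.range n, p := by gcongr with i; exact hvar i
      _ = _ := by simp; ring
  have hSm : Integrable (fun ω => S ω - m) P := hS1.sub (integrable_const _)
  have hl : ∫⁻ ω, ‖S ω - m‖ₑ ∂P = ENNReal.ofReal (∫ ω, |S ω - m| ∂P) :=
    (ofReal_integral_norm_eq_lintegral_enorm hSm).symm
  rw [hl]
  refine ⟨ENNReal.ofReal_le_ofReal ?_, ENNReal.ofReal_le_ofReal ?_⟩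
  · have hSc : Integrable (fun ω => |S ω - ∫ ω', S ω' ∂P|) P :=
      (hS1.sub (integrable_const _)).abs
    calc ∫ ω, |S ω - m| ∂P
        ≤ ∫ ω, (|S ω - ∫ ω', S ω' ∂P| + |(n : ℝ) / k * p - m|) ∂P := by
          refine integral_mono hSm.abs (hSc.add (integrable_const _)) fun ω => ?_
          rw [← hSmean]
          exact abs_sub_le _ _ _
      _ = ∫ ω, |S ω - ∫ ω', S ω' ∂P| ∂P + |(n : ℝ) / k * p - m| := by
          rw [integral_add hSc (integrable_const _)]; simp
      _ ≤ _ := by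
          gcongr
          exact (integral_abs_sub_le_sqrt_variance hS).trans (Real.sqrt_le_sqrt hSvar)
  · calc ∫ ω, |S ω - m| ∂P ≤ ∫ ω, (S ω + m) ∂P := by
          refine integral_mono hSm.abs (hS1.add (integrable_const _)) fun ω => ?_
          have := hS0 ω
          exact abs_le.2 ⟨by dsimp only; linarith, by dsimp only; linarith⟩
      _ = _ := by rw [integral_add hS1 (integrable_const _), hSmean]; simp

end LawOfLargeNumbers

section Extremes

variable {E : Type*} [NormedAddCommGroup E] [NormedSpace ℝ E] [MeasurableSpace E] [BorelSpace E]
  {Ω₀ : Type*} [MeasurableSpace Ω₀] {P₀ : Measure Ω₀} {Z₀ : Ω₀ → E} {α β : ℝ} {μ : Measure E}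
  {k : ℕ → ℕ} {a : ℕ → ℝ}

/-- The sets `{f > t, ‖z‖ > s}` are continuity sets for all but countably many `t`. -/
theorem IsRegularlyVarying.ae_measure_frontier_eq_zero (h : IsRegularlyVarying P₀ Z₀ α μ)
    {f : E → ℝ} (hf : Continuous f) {s : ℝ} (hs : 0 < s) :
    ∀ᵐ t : ℝ, μ (frontier {z | t < f z ∧ s < ‖z‖}) = 0 := by
  have hfin : IsFiniteMeasure (μ.restrict {z | s < ‖z‖}) :=
    ⟨by rw [Measure.restrict_apply_univ]; exact h.measure_lt_norm_lt_top hs⟩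
  have hc := Measure.countable_meas_level_set_pos (μ := μ.restrict {z | s < ‖z‖}) hf.measurable
  filter_upwards [hc.ae_notMem volume] with t ht
  have ht0 : μ ({z | f z = t} ∩ {z | s < ‖z‖}) = 0 := by
    have h1 : MeasurableSet {z | f z = t} := hf.measurable (measurableSet_singleton t)
    rw [← Measure.restrict_apply h1]
    simpa using ht
  refine measure_mono_null (t := ({z | f z = t} ∩ {z | s < ‖z‖}) ∪ {z | ‖z‖ = s}) ?_
    (measure_union_null ht0 (h.measure_norm_eq hs))
  intro z hz
  have h1 := frontier_inter_subset {z | t < f z} {z : E | s < ‖z‖} hz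
  rcases h1 with ⟨h2, h3⟩ | ⟨_, h3⟩
  · have h4 : f z = t := (frontier_lt_subset_eq continuous_const hf h2).symm
    have h5 : s ≤ ‖z‖ := closure_lt_subset_le continuous_const continuous_norm h3
    rcases h5.eq_or_lt with h6 | h6
    · exact Or.inr h6.symm
    · exact Or.inl ⟨h4, h6⟩
  · exact Or.inr (frontier_lt_subset_eq continuous_const continuous_norm h3).symm

theorem integral_Ioi_indicator_lt (x : ℝ) (hx : 0 ≤ x) (p : Prop) [Decidable p] :
    IntegrableOn (fun t : ℝ => if t < x ∧ p then (1 : ℝ) else 0) (Set.Ioi 0) ∧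
    ∫ t in Set.Ioi (0 : ℝ), (if t < x ∧ p then (1 : ℝ) else 0) = if p then x else 0 := by
  by_cases hp : p
  · simp only [hp, and_true, if_true]
    have h1 : (fun t : ℝ => if t < x then (1 : ℝ) else 0) = (Set.Iio x).indicator 1 := by
      ext t; simp [Set.indicator_apply]
    have h2 : volume.restrict (Set.Ioi (0 : ℝ)) (Set.Iio x) = ENNReal.ofReal x := by
      rw [Measure.restrict_apply measurableSet_Iio, Set.inter_comm, Set.Ioi_inter_Iio,
        Real.volume_Ioo, sub_zero]
    rw [h1, integral_indicator_one measurableSet_Iio]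
    refine ⟨?_, ?_⟩
    · refine (integrable_indicator_iff measurableSet_Iio).2 (integrableOn_const ?_ ?_)
      · rw [h2]; exact ENNReal.ofReal_ne_top
      · simp
    · rw [Measure.real, h2, ENNReal.toReal_ofReal hx]
  · simp [hp]

/-- A uniform dominating function for the level sets `{f > t, ‖z‖ > s}`: since `f` grows at most
quadratically, these lie in `{‖z‖ > √(c (1 + t))}`, whose rescaled probabilities are
`O((1 + t) ^ (-β / 2))`, an integrable function of `t`. -/
theorem IsIntermediateScaling.exists_dominating {Q : Measure E}
    [IsFiniteMeasure Q] (h : IsRegularlyVarying P₀ Z₀ α μ)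
    (hsc : IsIntermediateScaling Q μ k a β) (hβ : 2 < β)
    {f : E → ℝ} {C : ℝ} (hC : 0 < C) (hfC : ∀ z, f z ≤ C * ‖z‖ ^ 2) {s : ℝ} (hs : 0 < s) :
    ∃ G : ℝ → ℝ, Measurable G ∧ ∫⁻ t in Set.Ioi (0 : ℝ), ENNReal.ofReal (G t) < ∞ ∧
      (∀ᶠ n : ℕ in atTop, ∀ t > 0, ((n : ℝ) / k n) *
        Q.real {z | (a n)⁻¹ • z ∈ {z | t < f z ∧ s < ‖z‖}} ≤ G t) ∧
      ∀ t > 0, μ.real {z | t < f z ∧ s < ‖z‖} ≤ G t := by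
  set c : ℝ := min (s ^ 2) C⁻¹ / 2 with hc
  have hc0 : 0 < c := by positivity
  have hsub : ∀ t > 0, {z | t < f z ∧ s < ‖z‖} ⊆ {z | Real.sqrt (c * (1 + t)) < ‖z‖} := by
    rintro t ht z ⟨h1, h2⟩
    refine (Real.sqrt_lt' (hs.trans h2)).2 ?_
    have h3 : s ^ 2 < ‖z‖ ^ 2 := by gcongr
    have h4 : C⁻¹ * t < ‖z‖ ^ 2 := by
      rw [inv_mul_lt_iff₀ hC]; exact h1.trans_le (hfC z)
    have h5 : min (s ^ 2) C⁻¹ ≤ s ^ 2 := min_le_left _ _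
    have h6 : min (s ^ 2) C⁻¹ * t ≤ C⁻¹ * t := by gcongr; exact min_le_right _ _
    rw [hc]
    linarith
  obtain ⟨K, hK⟩ := hsc.tail_le (Real.sqrt c) (by positivity)
  have hsqrt : ∀ t > 0, Real.sqrt c ≤ Real.sqrt (c * (1 + t)) := fun t ht =>
    Real.sqrt_le_sqrt (by nlinarith)
  have hpow : ∀ t > 0, (Real.sqrt (c * (1 + t))) ^ (-β)
      = c ^ (-(β / 2)) * (1 + ‖t‖) ^ (-(β / 2)) := by
    intro t ht
    rw [Real.norm_of_nonneg ht.le, ← Real.mul_rpow hc0.le (by positivity), Real.sqrt_eq_rpow,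
      ← Real.rpow_mul (by positivity)]
    congr 1; ring
  refine ⟨fun t => K * (c ^ (-(β / 2)) * (1 + ‖t‖) ^ (-(β / 2))), by fun_prop, ?_, ?_, ?_⟩
  · have hi : Integrable (fun t : ℝ => K * (c ^ (-(β / 2)) * (1 + ‖t‖) ^ (-(β / 2)))) :=
      ((integrable_one_add_norm (by simp; linarith)).const_mul _).const_mul _
    exact (setLIntegral_le_lintegral _ _).trans_lt
      ((lintegral_mono fun t => Real.ofReal_le_enorm _).trans_lt hi.2)
  · filter_upwards [hK] with n hn t ht
    rw [← hpow t ht]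
    refine le_trans ?_ (hn _ (hsqrt t ht))
    refine mul_le_mul_of_nonneg_left (measureReal_mono fun z hz => ?_) (by positivity)
    exact hsub t ht hz
  · intro t ht
    dsimp only
    rw [← hpow t ht]
    have hu : 0 < Real.sqrt (c * (1 + t)) := by positivity
    refine (measureReal_mono (hsub t ht) (h.measure_lt_norm_lt_top hu).ne).trans ?_
    refine le_of_tendsto (hsc.tendsto _ (measurableSet_lt_norm _)
      (boundedAway_of_forall_le_norm hu fun z (hz : _ < ‖z‖) => hz.le)
      (h.measure_frontier_lt_norm hu)) ?_
    filter_upwards [hK] with n hn using hn _ (hsqrt t ht)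

theorem IsIntermediateScaling.integrableOn {Q : Measure E}
    [IsFiniteMeasure Q] (h : IsRegularlyVarying P₀ Z₀ α μ)
    (hsc : IsIntermediateScaling Q μ k a β) (hβ : 2 < β)
    {f : E → ℝ} (hf : Continuous f) (hf0 : ∀ z, 0 ≤ f z)
    {C : ℝ} (hC : 0 < C) (hfC : ∀ z, f z ≤ C * ‖z‖ ^ 2) {s : ℝ} (hs : 0 < s) :
    IntegrableOn f {z | s < ‖z‖} μ := by
  obtain ⟨G, _, hG, _, hμG⟩ := hsc.exists_dominating h hβ hC hfC hs
  refine ⟨hf.measurable.aestronglyMeasurable, ?_⟩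
  rw [hasFiniteIntegral_iff_ofReal (Eventually.of_forall hf0),
    lintegral_eq_lintegral_meas_lt _ (Eventually.of_forall hf0) hf.measurable.aemeasurable]
  refine lt_of_le_of_lt (setLIntegral_mono' measurableSet_Ioi fun t ht => ?_) hG
  rw [Measure.restrict_apply (isOpen_lt continuous_const hf).measurableSet]
  have hfin : μ {z | t < f z ∧ s < ‖z‖} ≠ ∞ :=
    ((measure_mono fun z hz => hz.2).trans_lt (h.measure_lt_norm_lt_top hs)).ne
  exact (ENNReal.le_ofReal_iff_toReal_le hfin (measureReal_nonneg.trans (hμG t ht))).2 (hμG t ht)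

variable {Ω : Type*} [MeasurableSpace Ω] {P : Measure Ω} {Z : ℕ → Ω → E} {Q : Measure E}

theorem measureReal_preimage_inv_smul (hZ : ∀ i, Measurable (Z i)) (hQ : ∀ i, P.map (Z i) = Q)
    {A : Set E} (hA : MeasurableSet A) (c : ℝ) (i : ℕ) :
    P.real ((fun ω => c⁻¹ • Z i ω) ⁻¹' A) = Q.real {z | c⁻¹ • z ∈ A} := by
  have h1 : MeasurableSet {z | c⁻¹ • z ∈ A} := measurable_const_smul c⁻¹ hA
  rw [← hQ i, map_measureReal_apply (hZ i) h1]
  rfl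

theorem iIndepFun_inv_smul (hind : iIndepFun Z P) (c : ℝ) :
    iIndepFun (fun i ω => c⁻¹ • Z i ω) P :=
  hind.comp (fun _ z => c⁻¹ • z) fun _ => measurable_const_smul _

variable [IsProbabilityMeasure P]

theorem IsIntermediateScaling.tendsto_lintegral_frequency_sub
    (hsc : IsIntermediateScaling Q μ k a β) (hk : Tendsto k atTop atTop)
    (hZ : ∀ i, Measurable (Z i)) (hind : iIndepFun Z P) (hQ : ∀ i, P.map (Z i) = Q)
    {A : Set E} (hA : MeasurableSet A) (hA0 : BoundedAway A) (hAf : μ (frontier A) = 0) :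
    Tendsto (fun n => ∫⁻ ω, ‖(k n : ℝ)⁻¹ * ∑ i ∈ Finset.range n,
      A.indicator 1 ((a n)⁻¹ • Z i ω) - μ.real A‖ₑ ∂P) atTop (𝓝 0) := by
  have hbias := hsc.tendsto A hA hA0 hAf
  have hkinv : Tendsto (fun n => ((k n : ℝ))⁻¹) atTop (𝓝 0) :=
    tendsto_inv_atTop_zero.comp (tendsto_natCast_atTop_atTop.comp hk)
  have h1 := ((hbias.mul hkinv).sqrt).add (hbias.sub_const (μ.real A)).abs
  simp only [mul_zero, Real.sqrt_zero, sub_self, abs_zero, add_zero] at h1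
  have h2 := ENNReal.tendsto_ofReal h1
  rw [ENNReal.ofReal_zero] at h2
  refine tendsto_of_tendsto_of_tendsto_of_le_of_le tendsto_const_nhds h2 (fun _ => zero_le) ?_
  intro n
  exact (lintegral_enorm_frequency_sub_le (fun i => (hZ i).const_smul (a n)⁻¹)
    (iIndepFun_inv_smul hind (a n)) hA (measureReal_preimage_inv_smul hZ hQ hA (a n)) n (k n)
    measureReal_nonneg).1

/-- Empirical frequencies of continuity sets bounded away from the origin are consistent. -/
theorem IsIntermediateScaling.tendsto_frequency
    (hsc : IsIntermediateScaling Q μ k a β) (hk : Tendsto k atTop atTop)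
    (hZ : ∀ i, Measurable (Z i)) (hind : iIndepFun Z P) (hQ : ∀ i, P.map (Z i) = Q)
    {A : Set E} (hA : MeasurableSet A) (hA0 : BoundedAway A) (hAf : μ (frontier A) = 0) :
    Tendsto (fun x : ℕ × Ω => (k x.1 : ℝ)⁻¹ * ∑ i ∈ Finset.range x.1,
      A.indicator 1 ((a x.1)⁻¹ • Z i x.2)) (highProbability P) (𝓝 (μ.real A)) := by
  refine tendsto_highProbability_of_tendsto_lintegral (f := fun n ω => (k n : ℝ)⁻¹ *
    ∑ i ∈ Finset.range n, A.indicator 1 ((a n)⁻¹ • Z i ω)) (fun n => ?_)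
    (hsc.tendsto_lintegral_frequency_sub hk hZ hind hQ hA hA0 hAf)
  refine measurable_const.mul (Finset.measurable_sum _ fun i _ => ?_)
  exact (measurable_one.indicator hA).comp ((hZ i).const_smul (a n)⁻¹)

/-- Sums of a function of at most quadratic growth over the observations beyond a deterministic
level are consistent. By the layer cake formula, the sum and its limit are the integrals over `t`
of the empirical frequencies and of the `μ`-measures of the level sets `{f > t, ‖z‖ > s}`. The mean
absolute difference of the latter two tends to zero for almost every `t` and is dominated. -/
theorem IsIntermediateScaling.tendsto_sum_indicator [IsFiniteMeasure Q]
    (h : IsRegularlyVarying P₀ Z₀ α μ)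
    (hsc : IsIntermediateScaling Q μ k a β) (hβ : 2 < β) (hk : Tendsto k atTop atTop)
    (hZ : ∀ i, Measurable (Z i)) (hind : iIndepFun Z P) (hQ : ∀ i, P.map (Z i) = Q)
    {f : E → ℝ} (hf : Continuous f) (hf0 : ∀ z, 0 ≤ f z)
    {C : ℝ} (hC : 0 < C) (hfC : ∀ z, f z ≤ C * ‖z‖ ^ 2) {s : ℝ} (hs : 0 < s) :
    Tendsto (fun x : ℕ × Ω => (k x.1 : ℝ)⁻¹ * ∑ i ∈ Finset.range x.1,
      {z | s < ‖z‖}.indicator f ((a x.1)⁻¹ • Z i x.2)) (highProbability P)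
      (𝓝 (∫ z in {z | s < ‖z‖}, f z ∂μ)) := by
  classical
  obtain ⟨G, hGm, hG, hnG, hμG⟩ := hsc.exists_dominating h hβ hC hfC hs
  set A : ℝ → Set E := fun t => {z | t < f z ∧ s < ‖z‖} with hAdef
  have hAm : ∀ t, MeasurableSet (A t) := fun t =>
    (isOpen_lt continuous_const hf).measurableSet.inter (measurableSet_lt_norm s)
  have hA0 : ∀ t, BoundedAway (A t) := fun t =>
    boundedAway_of_forall_le_norm hs fun z hz => hz.2.le
  have hind_eq : ∀ t z, (A t).indicator (1 : E → ℝ) z = if t < f z ∧ s < ‖z‖ then 1 else 0 :=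
    fun t z => by simp [Set.indicator_apply, hAdef]
  have hint := hsc.integrableOn h hβ hf hf0 hC hfC hs
  have hmreal : ∀ t, (μ.restrict {z | s < ‖z‖}).real {z | t < f z} = μ.real (A t) := fun t => by
    rw [measureReal_restrict_apply (isOpen_lt continuous_const hf).measurableSet]
    rfl
  have hlimit : ∫ z in {z | s < ‖z‖}, f z ∂μ = ∫ t in Set.Ioi (0 : ℝ), μ.real (A t) := by
    rw [hint.integral_eq_integral_meas_lt (Eventually.of_forall hf0)]
    simp_rw [hmreal]
  have hmanti : Antitone fun t => μ.real (A t) := fun t t' htt' =>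
    measureReal_mono (fun z hz => ⟨htt'.trans_lt hz.1, hz.2⟩)
      ((measure_mono fun z hz => hz.2).trans_lt (h.measure_lt_norm_lt_top hs)).ne
  have hmint : IntegrableOn (fun t => μ.real (A t)) (Set.Ioi 0) := by
    refine ⟨hmanti.measurable.aestronglyMeasurable, ?_⟩
    refine lt_of_le_of_lt (setLIntegral_mono' measurableSet_Ioi fun t ht => ?_) hG
    rw [Real.enorm_of_nonneg measureReal_nonneg]
    exact ENNReal.ofReal_le_ofReal (hμG t ht)
  set N : ℕ → ℝ → Ω → ℝ := fun n t ω =>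
    (k n : ℝ)⁻¹ * ∑ i ∈ Finset.range n, (A t).indicator 1 ((a n)⁻¹ • Z i ω) with hNdef
  have hNint : ∀ n ω, IntegrableOn (fun t => N n t ω) (Set.Ioi 0) := fun n ω => by
    refine (integrable_finsetSum _ fun i _ => ?_).const_mul _
    simp_rw [hind_eq]
    exact (integral_Ioi_indicator_lt _ (hf0 _) _).1
  have hsum : ∀ n ω, (k n : ℝ)⁻¹ * ∑ i ∈ Finset.range n,
      {z | s < ‖z‖}.indicator f ((a n)⁻¹ • Z i ω) = ∫ t in Set.Ioi (0 : ℝ), N n t ω := by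
    intro n ω
    rw [integral_const_mul, integral_finsetSum]
    · congr 1
      refine Finset.sum_congr rfl fun i _ => ?_
      simp_rw [hind_eq]
      rw [(integral_Ioi_indicator_lt _ (hf0 _) _).2]
      simp [Set.indicator_apply]
    · intro i _
      simp_rw [hind_eq]
      exact (integral_Ioi_indicator_lt _ (hf0 _) _).1
  have hNmeas : ∀ n, Measurable (Function.uncurry fun t ω => ‖N n t ω - μ.real (A t)‖ₑ) := by
    intro n
    refine Measurable.enorm (Measurable.sub ?_ (hmanti.measurable.comp measurable_fst))
    refine measurable_const.mul (Finset.measurable_sum _ fun i _ => ?_)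
    simp_rw [hind_eq]
    have hz : Measurable fun x : ℝ × Ω => (a n)⁻¹ • Z i x.2 :=
      ((hZ i).comp measurable_snd).const_smul (a n)⁻¹
    exact Measurable.ite ((measurableSet_lt measurable_fst (hf.measurable.comp hz)).inter
      (hz (measurableSet_lt_norm s))) measurable_const measurable_const
  refine tendsto_highProbability_of_tendsto_lintegral (f := fun n ω => (k n : ℝ)⁻¹ *
    ∑ i ∈ Finset.range n, {z | s < ‖z‖}.indicator f ((a n)⁻¹ • Z i ω)) (fun n => ?_) ?_
  · refine measurable_const.mul (Finset.measurable_sum _ fun i _ => ?_)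
    exact (hf.measurable.indicator (measurableSet_lt_norm s)).comp ((hZ i).const_smul (a n)⁻¹)
  have hdom : Tendsto (fun n => ∫⁻ t in Set.Ioi (0 : ℝ), ∫⁻ ω, ‖N n t ω - μ.real (A t)‖ₑ ∂P)
      atTop (𝓝 (∫⁻ t in Set.Ioi (0 : ℝ), 0)) := by
    refine tendsto_lintegral_filter_of_dominated_convergence'
      (fun t => ENNReal.ofReal (G t) + ENNReal.ofReal (G t)) ?_ ?_ ?_ ?_
    · exact Eventually.of_forall fun n => ((hNmeas n).lintegral_prod_right).aemeasurable
    · filter_upwards [hnG] with n hn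
      refine (ae_restrict_iff' measurableSet_Ioi).2 (Eventually.of_forall fun t ht => ?_)
      refine (lintegral_enorm_frequency_sub_le (fun i => (hZ i).const_smul (a n)⁻¹)
        (iIndepFun_inv_smul hind (a n)) (hAm t) (measureReal_preimage_inv_smul hZ hQ (hAm t) (a n))
        n (k n) measureReal_nonneg).2.trans ?_
      have hG0 : 0 ≤ G t := measureReal_nonneg.trans (hμG t ht)
      rw [← ENNReal.ofReal_add hG0 hG0]
      exact ENNReal.ofReal_le_ofReal (add_le_add (hn t ht) (hμG t ht))
    · rw [lintegral_add_left hGm.ennreal_ofReal]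
      exact (ENNReal.add_lt_top.2 ⟨hG, hG⟩).ne
    · filter_upwards [ae_restrict_of_ae (h.ae_measure_frontier_eq_zero hf hs)] with t ht
      exact hsc.tendsto_lintegral_frequency_sub hk hZ hind hQ (hAm t) (hA0 t) ht
  rw [lintegral_zero] at hdom
  refine tendsto_of_tendsto_of_tendsto_of_le_of_le tendsto_const_nhds hdom (fun _ => zero_le) ?_
  intro n
  dsimp only
  rw [lintegral_lintegral_swap (hNmeas n).aemeasurable]
  refine lintegral_mono fun ω => ?_
  rw [hsum, hlimit, ← integral_sub (hNint n ω) hmint]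
  exact enorm_integral_le_lintegral_enorm _

end Extremes

/-! ### Sums over the extreme observations -/

section ExtremeSums

variable {E : Type*} [NormedAddCommGroup E] [NormedSpace ℝ E] [MeasurableSpace E] [BorelSpace E]
  {Ω₀ : Type*} [MeasurableSpace Ω₀] {P₀ : Measure Ω₀} {Z₀ : Ω₀ → E} {α β : ℝ} {μ : Measure E}
  {k : ℕ → ℕ} {a : ℕ → ℝ}
  {Ω : Type*} [MeasurableSpace Ω] {P : Measure Ω} [IsProbabilityMeasure P]
  {Z : ℕ → Ω → E} {Q : Measure E}

/-- The order statistic `R_(k)` is asymptotically `a n`: it lies above `s * a n` with high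
probability if `s < 1`, and below if `1 < s`. -/
theorem IsIntermediateScaling.eventually_kthLargest (h : IsRegularlyVarying P₀ Z₀ α μ)
    (hsc : IsIntermediateScaling Q μ k a β) (hk : Tendsto k atTop atTop)
    (hkn : Tendsto (fun n : ℕ => (k n : ℝ) / (n : ℝ)) atTop (𝓝 0))
    (hZ : ∀ i, Measurable (Z i)) (hind : iIndepFun Z P) (hQ : ∀ i, P.map (Z i) = Q)
    {s : ℝ} (hs : 0 < s) :
    (s < 1 → ∀ᶠ x in highProbability P,
      s * a x.1 < kthLargest (fun i : Fin x.1 => ‖Z i x.2‖) (k x.1)) ∧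
    (1 < s → ∀ᶠ x in highProbability P,
      kthLargest (fun i : Fin x.1 => ‖Z i x.2‖) (k x.1) ≤ s * a x.1) := by
  have hfreq := hsc.tendsto_frequency hk hZ hind hQ (measurableSet_lt_norm s)
    (boundedAway_of_forall_le_norm hs fun z (hz : s < ‖z‖) => hz.le) (h.measure_frontier_lt_norm hs)
  rw [h.measureReal_lt_norm hs] at hfreq
  have hcard : ∀ (n : ℕ) (ω : Ω), 0 < a n →
      ∑ i ∈ Finset.range n, {z : E | s < ‖z‖}.indicator (1 : E → ℝ) ((a n)⁻¹ • Z i ω)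
        = ((Finset.univ.filter fun i : Fin n => s * a n < ‖Z i ω‖).card : ℝ) := by
    intro n ω hn
    rw [Finset.sum_range, Finset.natCast_card_filter]
    refine Finset.sum_congr rfl fun i _ => ?_
    simp only [Set.indicator_apply, Set.mem_ofPred_eq, norm_smul, norm_inv, Real.norm_eq_abs,
      abs_of_pos hn, ← div_eq_inv_mul, lt_div_iff₀ hn, Pi.one_apply]
  have hdet : ∀ᶠ n in atTop, 0 < a n ∧ 1 ≤ k n ∧ k n ≤ n := by
    filter_upwards [hsc.pos, hk.eventually_ge_atTop 1, hkn.eventually_lt_const one_pos,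
      eventually_gt_atTop 0] with n h1 h2 h3 h4
    refine ⟨h1, h2, ?_⟩
    rw [div_lt_one (by exact_mod_cast h4)] at h3
    exact_mod_cast h3.le
  have hdet' := (tendsto_fst_highProbability P).eventually hdet
  constructor
  · intro hs1
    have h1 : 1 < s ^ (-α) := Real.one_lt_rpow_of_pos_of_lt_one_of_neg hs hs1
      (by linarith [h.index_pos])
    filter_upwards [hdet', hfreq.eventually_const_lt h1] with x ⟨ha, hk1, hkn⟩ hx
    rw [lt_kthLargest_iff _ hk1 hkn]
    rw [hcard _ _ ha, ← div_eq_inv_mul, one_lt_div (by exact_mod_cast hk1)] at hx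
    exact_mod_cast hx.le
  · intro hs1
    have h1 : s ^ (-α) < 1 := Real.rpow_lt_one_of_one_lt_of_neg hs1 (by linarith [h.index_pos])
    filter_upwards [hdet', hfreq.eventually_lt_const h1] with x ⟨ha, hk1, hkn⟩ hx
    rw [← not_lt, lt_kthLargest_iff _ hk1 hkn, not_le]
    rw [hcard _ _ ha, ← div_eq_inv_mul, div_lt_one (by exact_mod_cast hk1)] at hx
    exact_mod_cast hx

theorem IsRegularlyVarying.tendsto_integral_lt_norm (h : IsRegularlyVarying P₀ Z₀ α μ)
    {f : E → ℝ} (hint : ∀ s > 0, IntegrableOn f {z | s < ‖z‖} μ) :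
    Tendsto (fun s => ∫ z in {z | s < ‖z‖}, f z ∂μ) (𝓝 1) (𝓝 (∫ z in {z | 1 < ‖z‖}, f z ∂μ)) := by
  simp_rw [← integral_indicator (measurableSet_lt_norm (E := E) _)]
  have hle : ∀ᶠ s : ℝ in 𝓝 1, 2⁻¹ < s := lt_mem_nhds (by norm_num)
  refine tendsto_integral_filter_of_dominated_convergence
    (fun z => ‖{z : E | 2⁻¹ < ‖z‖}.indicator f z‖) ?_ ?_ ?_ ?_
  · filter_upwards [hle] with s hs
    exact ((integrable_indicator_iff (measurableSet_lt_norm s)).2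
      (hint s (lt_trans (by norm_num) hs))).aestronglyMeasurable
  · filter_upwards [hle] with s hs
    refine Eventually.of_forall fun z => ?_
    refine norm_indicator_le_of_subset (fun z (hz : s < ‖z‖) => ?_) f z
    exact hs.trans hz
  · exact ((integrable_indicator_iff (measurableSet_lt_norm _)).2
      (hint 2⁻¹ (by norm_num))).norm
  · have h1 : ∀ᵐ z ∂μ, ‖z‖ ≠ 1 := by
      rw [ae_iff]
      simpa using h.measure_norm_eq one_pos
    filter_upwards [h1] with z hz
    refine tendsto_const_nhds.congr' ?_
    rcases hz.lt_or_gt with hz | hz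
    · filter_upwards [lt_mem_nhds hz] with s hs
      simp [hs.le, hz.le]
    · filter_upwards [gt_mem_nhds hz] with s hs
      simp [hs, hz]

/-- Sums of a nonnegative function over the `k` extreme observations are consistent: since
`R_(k) ≈ a n`, they lie between the sums over `‖Z i‖ > s * a n` for `s > 1` and for `s < 1`. -/
theorem IsIntermediateScaling.tendsto_sum_extremes [IsFiniteMeasure Q]
    (h : IsRegularlyVarying P₀ Z₀ α μ)
    (hsc : IsIntermediateScaling Q μ k a β) (hβ : 2 < β) (hk : Tendsto k atTop atTop)
    (hkn : Tendsto (fun n : ℕ => (k n : ℝ) / (n : ℝ)) atTop (𝓝 0))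
    (hZ : ∀ i, Measurable (Z i)) (hind : iIndepFun Z P) (hQ : ∀ i, P.map (Z i) = Q)
    {f : E → ℝ} (hf : Continuous f) (hf0 : ∀ z, 0 ≤ f z)
    {C : ℝ} (hC : 0 < C) (hfC : ∀ z, f z ≤ C * ‖z‖ ^ 2) :
    Tendsto (fun x : ℕ × Ω => (k x.1 : ℝ)⁻¹ * ∑ i ∈ Finset.univ.filter
        (fun i : Fin x.1 => kthLargest (fun j : Fin x.1 => ‖Z j x.2‖) (k x.1) ≤ ‖Z i x.2‖),
        f ((a x.1)⁻¹ • Z i x.2)) (highProbability P)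
      (𝓝 (∫ z in {z | 1 < ‖z‖}, f z ∂μ)) := by
  have hcont := h.tendsto_integral_lt_norm
    (fun s hs => hsc.integrableOn h hβ hf hf0 hC hfC hs)
  have hT := fun (s : ℝ) (hs : 0 < s) =>
    hsc.tendsto_sum_indicator h hβ hk hZ hind hQ hf hf0 hC hfC hs
  have hpos := (tendsto_fst_highProbability P).eventually hsc.pos
  have hterm : ∀ (s c : ℝ) (z : E), 0 < c → {z | s < ‖z‖}.indicator f (c⁻¹ • z)
      = if s * c < ‖z‖ then f (c⁻¹ • z) else 0 := by
    intro s c z hc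
    simp only [Set.indicator_apply, Set.mem_ofPred_eq, norm_smul, norm_inv, Real.norm_eq_abs,
      abs_of_pos hc, ← div_eq_inv_mul, lt_div_iff₀ hc]
  refine tendsto_order.2 ⟨fun y hy => ?_, fun y hy => ?_⟩
  · obtain ⟨s, h1, h2⟩ := (((hcont.eventually_const_lt hy).filter_mono nhdsWithin_le_nhds).and
      (eventually_mem_nhdsWithin : ∀ᶠ s in 𝓝[>] (1 : ℝ), s ∈ Set.Ioi 1)).exists
    have hs : 0 < s := one_pos.trans h2
    filter_upwards [(hT s hs).eventually_const_lt h1, hpos,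
      (hsc.eventually_kthLargest h hk hkn hZ hind hQ hs).2 h2] with x h3 h4 h5
    refine h3.trans_le ?_
    gcongr
    rw [Finset.sum_range, Finset.sum_filter]
    refine Finset.sum_le_sum fun i _ => ?_
    rw [hterm _ _ _ h4]
    split_ifs with h6 h7 h7
    · exact le_rfl
    · exact absurd (h5.trans h6.le) h7
    · exact hf0 _
    · exact le_rfl
  · obtain ⟨s, h1, h2, hs⟩ := (((hcont.eventually_lt_const hy).filter_mono nhdsWithin_le_nhds).and
      ((eventually_mem_nhdsWithin : ∀ᶠ s in 𝓝[<] (1 : ℝ), s ∈ Set.Iio 1).and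
        ((lt_mem_nhds (zero_lt_one' ℝ)).filter_mono nhdsWithin_le_nhds))).exists
    filter_upwards [(hT s hs).eventually_lt_const h1, hpos,
      (hsc.eventually_kthLargest h hk hkn hZ hind hQ hs).1 h2] with x h3 h4 h5
    refine lt_of_le_of_lt ?_ h3
    gcongr
    rw [Finset.sum_range, Finset.sum_filter]
    refine Finset.sum_le_sum fun i _ => ?_
    rw [hterm _ _ _ h4]
    split_ifs with h6 h7 h7
    · exact le_rfl
    · exact absurd (h5.trans_le h6) h7
    · exact hf0 _
    · exact le_rfl

/-- By homogeneity of `μ`, a cone that `μ` charges is charged outside the unit ball. -/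
theorem IsRegularlyVarying.integral_pos (h : IsRegularlyVarying P₀ Z₀ α μ)
    {f : E → ℝ} (hf : Continuous f) (hf0 : ∀ z, 0 ≤ f z)
    (hhom : ∀ (c : ℝ) (z : E), f (c • z) = c ^ 2 * f z)
    (hint : IntegrableOn f {z | 1 < ‖z‖} μ) (hμ : μ {z | f z ≠ 0} ≠ 0) :
    0 < ∫ z in {z | 1 < ‖z‖}, f z ∂μ := by
  have hmeas : MeasurableSet {z | f z ≠ 0} := (isOpen_ne_fun hf continuous_const).measurableSet
  rw [integral_pos_iff_support_of_nonneg hf0 hint]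
  refine pos_iff_ne_zero.2 fun h0 => hμ ?_
  have h1 : μ ({z | f z ≠ 0} ∩ {z | 1 < ‖z‖}) = 0 := by
    rw [← Measure.restrict_apply hmeas]
    exact h0
  have h2 : ∀ m : ℕ, μ (((m : ℝ) + 1)⁻¹ • ({z | f z ≠ 0} ∩ {z | 1 < ‖z‖})) = 0 := by
    intro m
    rw [h.homogeneous _ (by positivity) _ (hmeas.inter (measurableSet_lt_norm 1)) (by simp), h1,
      mul_zero]
  refine measure_mono_null (fun z hz => ?_) (measure_iUnion_null h2)
  have hz0 : z ≠ 0 := by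
    rintro rfl
    refine hz ?_
    simpa using hhom 0 0
  have hzn : 0 < ‖z‖ := norm_pos_iff.2 hz0
  obtain ⟨m, hm⟩ := exists_nat_gt (‖z‖⁻¹)
  have hm0 : (0 : ℝ) < (m : ℝ) + 1 := by positivity
  refine Set.mem_iUnion.2 ⟨m, ?_⟩
  rw [Set.mem_smul_set_iff_inv_smul_mem₀ (inv_pos.2 hm0).ne', inv_inv]
  refine ⟨?_, ?_⟩
  · change f _ ≠ 0
    rw [hhom]
    exact mul_ne_zero (by positivity) hz
  · change 1 < ‖_‖
    rw [norm_smul, Real.norm_of_nonneg hm0.le, ← inv_lt_iff_one_lt_mul₀ hzn]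
    linarith

end ExtremeSums

/-! ### The extremal correlation coefficient -/

section Correlation

variable {H : Type*} [NormedAddCommGroup H]

theorem norm_fst_sq_le (p : H × H) : ‖p.1‖ ^ 2 ≤ 1 * ‖p‖ ^ 2 := by
  rw [one_mul]; gcongr; exact norm_fst_le p

theorem norm_snd_sq_le (p : H × H) : ‖p.2‖ ^ 2 ≤ 1 * ‖p‖ ^ 2 := by
  rw [one_mul]; gcongr; exact norm_snd_le p

theorem norm_add_sq_le (p : H × H) : ‖p.1 + p.2‖ ^ 2 ≤ 4 * ‖p‖ ^ 2 := by
  have h : ‖p.1 + p.2‖ ≤ 2 * ‖p‖ := by linarith [norm_add_le p.1 p.2, norm_fst_le p, norm_snd_le p]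
  calc ‖p.1 + p.2‖ ^ 2 ≤ (2 * ‖p‖) ^ 2 := by gcongr
    _ = _ := by ring

theorem norm_sub_sq_le (p : H × H) : ‖p.1 - p.2‖ ^ 2 ≤ 4 * ‖p‖ ^ 2 := by
  have h : ‖p.1 - p.2‖ ≤ 2 * ‖p‖ := by linarith [norm_sub_le p.1 p.2, norm_fst_le p, norm_snd_le p]
  calc ‖p.1 - p.2‖ ^ 2 ≤ (2 * ‖p‖) ^ 2 := by gcongr
    _ = _ := by ring

theorem measure_fst_ne_zero_of_marginalX [MeasurableSpace H] [BorelSpace H]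
    {μ : Measure (H × H)} (h : marginalX μ ≠ 0) :
    μ {p | ‖p.1‖ ^ 2 ≠ 0} ≠ 0 := by
  intro h0
  refine h (Measure.measure_univ_eq_zero.1 ?_)
  rw [marginalX, Measure.restrict_apply_univ,
    Measure.map_apply measurable_fst (measurableSet_singleton 0).compl, ← h0]
  congr 1
  ext p
  simp

theorem measure_snd_ne_zero_of_marginalY [MeasurableSpace H] [BorelSpace H]
    {μ : Measure (H × H)} (h : marginalY μ ≠ 0) :
    μ {p | ‖p.2‖ ^ 2 ≠ 0} ≠ 0 := by
  intro h0
  refine h (Measure.measure_univ_eq_zero.1 ?_)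
  rw [marginalY, Measure.restrict_apply_univ,
    Measure.map_apply measurable_snd (measurableSet_singleton 0).compl, ← h0]
  congr 1
  ext p
  simp

variable [InnerProductSpace ℝ H]

theorem inner_eq_norm_add_sq_sub_norm_sub_sq_div_four (x y : H) :
    ⟪x, y⟫ = (‖x + y‖ ^ 2 - ‖x - y‖ ^ 2) / 4 := by
  rw [norm_add_sq_real, norm_sub_sq_real]; ring

/-- The estimator is invariant under scaling of the observations and of the sums. Its numerator
is written by polarization in terms of sums of nonnegative quantities. -/
theorem rhoHat_eq_of_pos {n : ℕ} (k : ℕ) (z : Fin n → H × H) {c r : ℝ} (hc : 0 < c) (hr : 0 < r) :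
    rhoHat k (fun i => (z i).1) (fun i => (z i).2) =
      ((r * ∑ i with kthLargest (fun j => ‖z j‖) k ≤ ‖z i‖, ‖(c • z i).1 + (c • z i).2‖ ^ 2
        - r * ∑ i with kthLargest (fun j => ‖z j‖) k ≤ ‖z i‖, ‖(c • z i).1 - (c • z i).2‖ ^ 2) / 4)
      / (Real.sqrt (r * ∑ i with kthLargest (fun j => ‖z j‖) k ≤ ‖z i‖, ‖(c • z i).1‖ ^ 2)
        * Real.sqrt (r * ∑ i with kthLargest (fun j => ‖z j‖) k ≤ ‖z i‖, ‖(c • z i).2‖ ^ 2)) := by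
  have hext : extremeIndices k (fun i => (z i).1) (fun i => (z i).2)
      = Finset.univ.filter fun i => kthLargest (fun j => ‖z j‖) k ≤ ‖z i‖ := rfl
  have hrc : 0 < r * c ^ 2 := by positivity
  have hn : ∀ x : H, ‖c • x‖ ^ 2 = c ^ 2 * ‖x‖ ^ 2 := fun x => by
    rw [norm_smul, mul_pow, Real.norm_eq_abs, sq_abs]
  rw [rhoHat, hext]
  set s := Finset.univ.filter fun i => kthLargest (fun j => ‖z j‖) k ≤ ‖z i‖
  simp only [Prod.smul_fst, Prod.smul_snd, ← smul_add, ← smul_sub, hn, ← Finset.mul_sum, ← mul_assoc]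
  rw [Real.sqrt_mul hrc.le, Real.sqrt_mul hrc.le, ← mul_sub, ← Finset.sum_sub_distrib, mul_div_assoc]
  simp_rw [inner_eq_norm_add_sq_sub_norm_sub_sq_div_four, ← Finset.sum_div]
  rw [mul_mul_mul_comm, Real.mul_self_sqrt hrc.le, mul_div_mul_left _ _ hrc.ne']

variable [MeasurableSpace H]

theorem rhoXY_eq {μ : Measure (H × H)}
    (hadd : IntegrableOn (fun p : H × H => ‖p.1 + p.2‖ ^ 2) {p | 1 < ‖p‖} μ)
    (hsub : IntegrableOn (fun p : H × H => ‖p.1 - p.2‖ ^ 2) {p | 1 < ‖p‖} μ) :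
    rhoXY μ = ((∫ p in {p : H × H | 1 < ‖p‖}, ‖p.1 + p.2‖ ^ 2 ∂μ
        - ∫ p in {p : H × H | 1 < ‖p‖}, ‖p.1 - p.2‖ ^ 2 ∂μ) / 4)
      / (Real.sqrt (∫ p in {p : H × H | 1 < ‖p‖}, ‖p.1‖ ^ 2 ∂μ)
        * Real.sqrt (∫ p in {p : H × H | 1 < ‖p‖}, ‖p.2‖ ^ 2 ∂μ)) := by
  rw [← integral_sub hadd hsub, ← integral_div]
  simp_rw [← inner_eq_norm_add_sq_sub_norm_sub_sq_div_four]
  rfl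

variable [BorelSpace H]

/-- Consistency of the estimator, for measurable observations in a separable inner product
space. -/
theorem tendstoInMeasure_rhoHat [SecondCountableTopology H]
    {Ω₀ : Type*} [MeasurableSpace Ω₀] {P₀ : Measure Ω₀} [IsProbabilityMeasure P₀] {Z₀ : Ω₀ → H × H}
    {α : ℝ} (hα : 2 < α) {μ : Measure (H × H)} (h : IsRegularlyVarying P₀ Z₀ α μ)
    (hμX : marginalX μ ≠ 0) (hμY : marginalY μ ≠ 0)
    {Ω : Type*} [MeasurableSpace Ω] {P : Measure Ω} [IsProbabilityMeasure P]
    {Z : ℕ → Ω → H × H} (hZ : ∀ i, Measurable (Z i)) (hind : iIndepFun Z P)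
    (hQ : ∀ i, P.map (Z i) = P₀.map Z₀)
    {k : ℕ → ℕ} (hk : Tendsto k atTop atTop)
    (hkn : Tendsto (fun n : ℕ => (k n : ℝ) / (n : ℝ)) atTop (𝓝 0)) :
    TendstoInMeasure P
      (fun (n : ℕ) (ω : Ω) => rhoHat (k n) (fun i : Fin n => (Z i ω).1) (fun i : Fin n => (Z i ω).2))
      atTop (fun _ => rhoXY μ) := by
  have : IsProbabilityMeasure (P₀.map Z₀) := Measure.isProbabilityMeasure_map h.aemeasurable
  -- the exponent of the Potter bound has to lie strictly between `2` and `α`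
  obtain ⟨β, hβ2, hβα⟩ := exists_between hα
  obtain ⟨a, hsc⟩ := h.exists_intermediate (by linarith) hβα hk hkn
  have hsum := fun (f : H × H → ℝ) (hf : Continuous f) (hf0 : ∀ z, 0 ≤ f z) (C : ℝ) (hC : 0 < C)
    (hfC : ∀ z, f z ≤ C * ‖z‖ ^ 2) => hsc.tendsto_sum_extremes h hβ2 hk hkn hZ hind hQ hf hf0 hC hfC
  have hint := fun (f : H × H → ℝ) (hf : Continuous f) (hf0 : ∀ z, 0 ≤ f z) (C : ℝ) (hC : 0 < C)
    (hfC : ∀ z, f z ≤ C * ‖z‖ ^ 2) => hsc.integrableOn h hβ2 hf hf0 hC hfC one_pos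
  have hfst := hsum (fun p => ‖p.1‖ ^ 2) (by fun_prop) (fun _ => by positivity) 1 one_pos
    norm_fst_sq_le
  have hsnd := hsum (fun p => ‖p.2‖ ^ 2) (by fun_prop) (fun _ => by positivity) 1 one_pos
    norm_snd_sq_le
  have hadd := hsum (fun p => ‖p.1 + p.2‖ ^ 2) (by fun_prop) (fun _ => by positivity) 4 four_pos
    norm_add_sq_le
  have hsub := hsum (fun p => ‖p.1 - p.2‖ ^ 2) (by fun_prop) (fun _ => by positivity) 4 four_pos
    norm_sub_sq_le
  have hposX := h.integral_pos (f := fun p : H × H => ‖p.1‖ ^ 2) (by fun_prop)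
    (fun _ => by positivity) (fun c z => by simp [norm_smul, mul_pow])
    (hint _ (by fun_prop) (fun _ => by positivity) 1 one_pos norm_fst_sq_le)
    (measure_fst_ne_zero_of_marginalX hμX)
  have hposY := h.integral_pos (f := fun p : H × H => ‖p.2‖ ^ 2) (by fun_prop)
    (fun _ => by positivity) (fun c z => by simp [norm_smul, mul_pow])
    (hint _ (by fun_prop) (fun _ => by positivity) 1 one_pos norm_snd_sq_le)
    (measure_snd_ne_zero_of_marginalY hμY)
  apply tendstoInMeasure_of_tendsto_highProbability
  rw [rhoXY_eq (hint _ (by fun_prop) (fun _ => by positivity) 4 four_pos norm_add_sq_le)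
    (hint _ (by fun_prop) (fun _ => by positivity) 4 four_pos norm_sub_sq_le)]
  have hratio := ((hadd.sub hsub).div_const 4).div (hfst.sqrt.mul hsnd.sqrt)
    (mul_pos (Real.sqrt_pos.2 hposX) (Real.sqrt_pos.2 hposY)).ne'
  refine hratio.congr' ?_
  filter_upwards [(tendsto_fst_highProbability P).eventually hsc.pos,
    (tendsto_fst_highProbability P).eventually (hk.eventually_gt_atTop 0)] with x ha hkx
  have hkx' : (0 : ℝ) < k x.1 := by exact_mod_cast hkx
  exact (rhoHat_eq_of_pos (k x.1) (fun i : Fin x.1 => Z i x.2) (inv_pos.2 ha)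
    (inv_pos.2 hkx')).symm

end Correlation

end ExtremalCorrelation

theorem corollary1
    -- the function space `L²(T, ν)`, assumed separable, with its Borel σ-algebra
    {T : Type*} [MeasurableSpace T] (ν : Measure T)
    [TopologicalSpace.SeparableSpace (Lp ℝ 2 ν)]
    [MeasurableSpace (Lp ℝ 2 ν)] [BorelSpace (Lp ℝ 2 ν)]
    -- the bivariate random element `(X, Y)`
    {Ω₀ : Type*} [MeasurableSpace Ω₀] (P₀ : Measure Ω₀) [IsProbabilityMeasure P₀]
    (X Y : Ω₀ → Lp ℝ 2 ν)
    -- it has mean zero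
    (hX_mean : ∫ ω, X ω ∂P₀ = 0) (hY_mean : ∫ ω, Y ω ∂P₀ = 0)
    -- it is regularly varying with index `-α`, `α > 2`, and (normalized) exponent measure `μ`
    (α : ℝ) (hα : 2 < α) (μ : Measure (Lp ℝ 2 ν × Lp ℝ 2 ν))
    (hRV : ExtremalCorrelation.IsRegularlyVarying P₀ (fun ω => (X ω, Y ω)) α μ)
    -- the marginals of the exponent measure are non-degenerate
    (hμX : ExtremalCorrelation.marginalX μ ≠ 0) (hμY : ExtremalCorrelation.marginalY μ ≠ 0)
    -- the observations `(X_i, Y_i)` are independent copies of `(X, Y)`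
    {Ω : Type*} [MeasurableSpace Ω] (P : Measure Ω) [IsProbabilityMeasure P]
    (Xs Ys : ℕ → Ω → Lp ℝ 2 ν)
    (h_indep : iIndepFun (fun i ω => (Xs i ω, Ys i ω)) P)
    (h_ident : ∀ i, IdentDistrib (fun ω => (Xs i ω, Ys i ω)) (fun ω => (X ω, Y ω)) P P₀)
    -- `k = k(n) → ∞` and `k / n → 0`
    (k : ℕ → ℕ) (hk : Tendsto k atTop atTop)
    (hkn : Tendsto (fun n : ℕ => (k n : ℝ) / (n : ℝ)) atTop (𝓝 0)) :
    TendstoInMeasure P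
      (fun (n : ℕ) (ω : Ω) => ExtremalCorrelation.rhoHat (k n)
        (fun i : Fin n => Xs i ω) (fun i : Fin n => Ys i ω))
      atTop (fun _ => ExtremalCorrelation.rhoXY μ) := by
  have : SecondCountableTopology (Lp ℝ 2 ν) := UniformSpace.secondCountable_of_separable _
  -- the observations are only almost everywhere measurable: replace them by measurable versions
  have hae := fun i => (h_ident i).aemeasurable_fst.ae_eq_mk
  set Z : ℕ → Ω → Lp ℝ 2 ν × Lp ℝ 2 ν := fun i => (h_ident i).aemeasurable_fst.mk _
  have key := ExtremalCorrelation.tendstoInMeasure_rhoHat hα hRV hμX hμY (Z := Z)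
    (fun i => (h_ident i).aemeasurable_fst.measurable_mk) (h_indep.congr hae)
    (fun i => by rw [← (h_ident i).map_eq]; exact Measure.map_congr (hae i).symm) hk hkn
  refine key.congr_left fun n => ?_
  filter_upwards [ae_all_iff.2 hae] with ω hω
  have h1 : ∀ i, (Z i ω).1 = Xs i ω := fun i => (congrArg Prod.fst (hω i)).symm
  have h2 : ∀ i, (Z i ω).2 = Ys i ω := fun i => (congrArg Prod.snd (hω i)).symm
  simp only [h1, h2]
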